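/- **The random graph.** The one-edge-per-vertex LCD process generates a random directed graph $G_1^n$ (with loops) on the vertices $1,\dots,n$, named by arrival time, as follows. For $t=1,\dots,n$, vertex $t$ arrives and sends out exactly one edge $t\to s$, where, given the past, $$\Pr(s)=\frac{\deg_{t-1}(s)}{2t-1}\quad(1\le s<t),\qquad \Pr(s=t)=\frac1{2t-1}.$$ Here $\deg_{t-1}$ is the total degree (in-degree plus out-degree, so that a loop counts twice) just before the arrival of $t$. The graph $G_c^n$ is the union of $c$ independent copies of $G_1^n$, vertices being identified by arrival time. **The score.** Let $N(v)=\{u: v\to u \text{ is an edge}\}$ be the (out-)neighbourhood of $v$; it contains $v$ if there is a loop at $v$, and multiple edges are counted once. For an ordering $p=p_1,\dots,p_n$ of the vertices put $$\mathrm{NScore}(G,p)=\sum_{i=1}^{n-1}|N(p_i)\cap N(p_{i+1})|.$$ **Theorem.** Let $c\ge 0$ be a fixed integer. 1. As $n\to\infty$, uniformly over all orderings $p$ of $\{1,\dots,n\}$, $$\mathbb E\big(\mathrm{NScore}(G_c^n,p)\big)=\Big(\tfrac14+o(1)\Big)\sum_{i=1}^{n-1}\ \sum_{1\le a\le \min(p_i,p_{i+1})}\frac{c(c+1)}{a\sqrt{p_i\,p_{i+1}}}.$$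 That is, for every $\varepsilon>0$ there is an $n_0$, depending only on $c$ and $\varepsilon$, such that for all $n\ge n_0$ and all orderings $p$ the two sides, with the $o(1)$ left out, differ by at most $\varepsilon$ times the right-hand side. 2. Ordering by attachment time is asymptotically best: for every $\varepsilon>0$ there is an $n_0$, depending only on $c$ and $\varepsilon$, such that for all $n\ge n_0$ and all orderings $p$ of $\{1,\dots,n\}$, $$\mathbb E\big(\mathrm{NScore}(G_c^n,p)\big)\le(1+\varepsilon)\,\mathbb E\big(\mathrm{NScore}(G_c^n,\mathrm{id})\big),\qquad \mathrm{id}=1,2,\dots,n.$$ -/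

import Mathlib

open MeasureTheory
open scoped ENNReal

namespace PrefAttach

/-- A realisation of the one-edge-per-vertex process after `t` steps is a map `f : Fin t → Fin t`:
the vertex of `Fin t` with value `i` is the one that arrives at time `i + 1`, and the edge it brings
is the directed edge `i → f i`.  `deg f s` is the (total) degree of `s`; a loop counts twice. -/
def deg {t : ℕ} (f : Fin t → Fin t) (s : Fin t) : ℕ :=
  ∑ i : Fin t, ((if i = s then 1 else 0) + (if f i = s then 1 else 0))

/-- The weight with which the new vertex, arriving at time `t + 1`, attaches to `s`: the current
degree of `s` if `s` is an old vertex, and `1` if `s` is the new vertex itself (a loop). -/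
def attachWeight {t : ℕ} (f : Fin t → Fin t) (s : Fin (t + 1)) : ℕ :=
  Fin.lastCases (motive := fun _ => ℕ) 1 (fun i => deg f i) s

theorem sum_attachWeight {t : ℕ} (f : Fin t → Fin t) :
    ∑ s, attachWeight f s = 2 * t + 1 := by
  have h : ∑ s : Fin t, deg f s = 2 * t := by
    unfold deg
    rw [Finset.sum_comm]
    simp [Finset.sum_add_distrib, mul_comm]
  rw [Fin.sum_univ_castSucc]
  simp [attachWeight, h]

/-- The law of the endpoint of the edge sent out by the vertex arriving at time `t + 1`:
an old vertex `s` has probability `deg s / (2 (t + 1) - 1)`, a loop `1 / (2 (t + 1) - 1)`. -/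
noncomputable def attachStep {t : ℕ} (f : Fin t → Fin t) : PMF (Fin (t + 1)) :=
  PMF.ofFintype (fun s => (attachWeight f s : ℝ≥0∞) / ((2 * t + 1 : ℕ) : ℝ≥0∞)) (by
    simp only [div_eq_mul_inv]
    rw [← Finset.sum_mul, ← Nat.cast_sum, sum_attachWeight]
    exact ENNReal.mul_inv_cancel (by simp) (ENNReal.natCast_ne_top _))

/-- Add the new vertex together with its edge to `s`. -/
def extend {t : ℕ} (f : Fin t → Fin t) (s : Fin (t + 1)) : Fin (t + 1) → Fin (t + 1) :=
  Fin.snoc (α := fun _ => Fin (t + 1)) (fun i => (f i).castSucc) s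

/-- The law of `G_1^n`, the preferential attachment process with one edge per vertex. -/
noncomputable def oneEdgeLaw : (n : ℕ) → PMF (Fin n → Fin n)
  | 0 => PMF.pure id
  | t + 1 => (oneEdgeLaw t).bind fun f => (attachStep f).map (extend f)

/-- The law of `c` independent runs of the process `G_1^n`. -/
noncomputable def lcdMeasure (c n : ℕ) : Measure (Fin c → Fin n → Fin n) :=
  Measure.pi fun _ => (oneEdgeLaw n).toMeasure

/-- The graph `G_c^n`: the union of the `c` runs, vertices being identified by arrival time.
Edges point from the later vertex to the earlier one to which it attached. -/
def lcdGraph {c n : ℕ} (F : Fin c → Fin n → Fin n) : Digraph (Fin n) where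
  Adj v u := ∃ k, F k v = u

/-- The neighbourhood `N(v) = {u | vu ∈ E(G)}` in a directed graph. -/
def nbhd {V : Type*} (G : Digraph V) (v : V) : Set V := {u | G.Adj v u}

/-- The score of the ordering `p 0, …, p (n - 1)` of the vertices of `G`:
the sum over consecutive vertices of the number of common neighbours. -/
noncomputable def nscore {V : Type*} {n : ℕ} (G : Digraph V) (p : Fin n ≃ V) : ℕ :=
  ∑ i : Fin (n - 1),
    (nbhd G (p ⟨i, by omega⟩) ∩ nbhd G (p ⟨i + 1, by omega⟩)).ncard

/-- The expected score of the ordering `p` of the vertices of `G_c^n`. -/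
noncomputable def expectedNScore (c : ℕ) {n : ℕ} (p : Fin n ≃ Fin n) : ℝ :=
  ∫ F, (nscore (lcdGraph F) p : ℝ) ∂(lcdMeasure c n)

/-- The arrival time in `{1, …, n}` of a vertex. -/
def time {n : ℕ} (v : Fin n) : ℕ := v + 1

/-- `∑_{i=1}^{n-1} ∑_{1 ≤ a ≤ min(p_i, p_{i+1})} c (c + 1) / (a √(p_i p_{i+1}))`, where the vertices
of the ordering are named by their arrival times. -/
noncomputable def attachSum (c : ℕ) {n : ℕ} (p : Fin n ≃ Fin n) : ℝ :=
  ∑ i : Fin (n - 1),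
    ∑ a ∈ Finset.Icc 1 (min (time (p ⟨i, by omega⟩)) (time (p ⟨i + 1, by omega⟩))),
      (c * (c + 1) : ℝ) /
        (a * √((time (p ⟨i, by omega⟩) : ℝ) * (time (p ⟨i + 1, by omega⟩) : ℝ)))

end PrefAttach

namespace PrefAttach

/-! Fix vertices u < v and s ≤ u, and let a, b, r be the probabilities in one copy that u, that v,
and that both attach to s. Attachment is a Pólya urn: the weight w of s and the product w(w + 1)
grow in mean by the deterministic factors 1 + 1/(2t + 1) and 1 + 2/(2t + 1), which gives closed
products for a, b, r (`oneEdgeExp_hits`, `oneEdgeExp_hits_mul_hits`). In terms of arrival times, a ≈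
1/(2√(su)), b ≈ 1/(2√(sv)) and r ≈ 1/(2s√(uv)) ≈ 2ab, all with relative error O(1/s). In c copies s
is a common neighbour with probability cr + c(c - 1)ab to leading order (`commonProb_bounds`), that
is c(c + 1)/(4s√(uv)).

The error O(1/(s²√(uv))) is summable over s, so each consecutive pair contributes an error
O(1/√(uv)), against a main term of order H/√(uv), where H is the harmonic number of min(u, v). Few
pairs contain an early vertex, and the main sum tends to infinity uniformly in the ordering, so the
error is negligible (`exists_sqrtSum_le`).

For optimality, AM-GM bounds the main sum of every ordering by the sum of H(x)/x over all vertices x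
(`harmSum_le_sum`), and arrival order attains this up to an additive 3 (`sum_le_harmSum_refl`). -/

/-! ### One step of the urn. -/

/-- The Pólya weight of the vertex `s`: one more than its in-degree. -/
noncomputable def weight {t : ℕ} (f : Fin t → Fin t) (s : ℕ) : ℝ :=
  1 + ∑ i : Fin t, if (f i : ℕ) = s then 1 else 0

/-- The indicator of the event that the edge brought by `v` ends at `s`. -/
noncomputable def hits {t : ℕ} (v s : ℕ) (f : Fin t → Fin t) : ℝ :=
  if ∃ h : v < t, (f ⟨v, h⟩ : ℕ) = s then 1 else 0

/-- Expectation in the one-edge process after `n` steps. -/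
noncomputable def oneEdgeExp (n : ℕ) (φ : (Fin n → Fin n) → ℝ) : ℝ :=
  ∫ f, φ f ∂(oneEdgeLaw n).toMeasure

/-- Every old vertex has out-degree 1, and the new vertex has in-degree 0, so one formula covers old
vertices and the loop. -/
theorem attachWeight_eq_weight {t : ℕ} (f : Fin t → Fin t) (s : Fin (t + 1)) :
    (attachWeight f s : ℝ) = weight f s := by
  refine Fin.lastCases ?_ (fun i => ?_) s
  · have : ∀ i, (f i : ℕ) ≠ t := fun i => (f i).isLt.ne
    simp [attachWeight, weight, this]
  · simp [attachWeight, weight, deg, Finset.sum_add_distrib, ← Fin.ext_iff]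

theorem sum_weight {t : ℕ} (f : Fin t → Fin t) :
    ∑ s : Fin (t + 1), weight f s = 2 * t + 1 := by
  simp_rw [← attachWeight_eq_weight]
  exact_mod_cast sum_attachWeight f

theorem weight_extend {t : ℕ} (f : Fin t → Fin t) (x : Fin (t + 1)) (s : ℕ) :
    weight (extend f x) s = weight f s + if (x : ℕ) = s then 1 else 0 := by
  simp [weight, extend, Fin.sum_univ_castSucc, add_assoc]

theorem hits_extend_of_lt {t v : ℕ} (f : Fin t → Fin t) (x : Fin (t + 1)) (s : ℕ) (hv : v < t) :
    hits v s (extend f x) = hits v s f := by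
  have : (⟨v, hv.trans (Nat.lt_succ_self t)⟩ : Fin (t + 1)) = Fin.castSucc ⟨v, hv⟩ := rfl
  simp only [hits, hv, hv.trans (Nat.lt_succ_self t), exists_true_left, this, extend,
    Fin.snoc_castSucc, Fin.val_castSucc]

theorem hits_extend_self {t : ℕ} (f : Fin t → Fin t) (x : Fin (t + 1)) (s : ℕ) :
    hits t s (extend f x) = if (x : ℕ) = s then 1 else 0 := by
  have : (⟨t, Nat.lt_succ_self t⟩ : Fin (t + 1)) = Fin.last t := rfl
  simp only [hits, Nat.lt_succ_self, exists_true_left, this, extend, Fin.snoc_last]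

theorem oneEdgeExp_mul_const (n : ℕ) (φ : (Fin n → Fin n) → ℝ) (r : ℝ) :
    oneEdgeExp n (fun f => φ f * r) = oneEdgeExp n φ * r :=
  integral_mul_const r φ

theorem oneEdgeExp_const (n : ℕ) (r : ℝ) : oneEdgeExp n (fun _ => r) = r := by
  simp [oneEdgeExp]

theorem oneEdgeExp_mono (n : ℕ) {φ ψ : (Fin n → Fin n) → ℝ} (h : ∀ f, φ f ≤ ψ f) :
    oneEdgeExp n φ ≤ oneEdgeExp n ψ :=
  integral_mono .of_finite .of_finite h

/-- The tower property: condition on the first `t` edges. Every exact formula below is an induction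
through this identity. -/
theorem oneEdgeExp_succ (t : ℕ) (φ : (Fin (t + 1) → Fin (t + 1)) → ℝ) :
    oneEdgeExp (t + 1) φ =
      oneEdgeExp t fun f => ∑ x : Fin (t + 1), weight f x / (2 * t + 1) * φ (extend f x) := by
  classical
  have key : ∀ g, ((oneEdgeLaw (t + 1)) g).toReal = ∑ f, ((oneEdgeLaw t) f).toReal *
      ∑ x : Fin (t + 1), if g = extend f x then weight f x / (2 * t + 1) else 0 := by
    intro g
    have h1 : ∀ f (x : Fin (t + 1)), (if g = extend f x then attachStep f x else 0) ≠ ∞ := by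
      intro f x
      split_ifs
      · exact PMF.apply_ne_top _ _
      · simp
    have h2 : oneEdgeLaw (t + 1) g = ∑ f, oneEdgeLaw t f *
        ∑ x : Fin (t + 1), if g = extend f x then attachStep f x else 0 := by
      simp only [oneEdgeLaw, PMF.bind_apply, PMF.map_apply, tsum_fintype]
      congr!
    rw [h2, ENNReal.toReal_sum]
    · refine Finset.sum_congr rfl fun f _ => ?_
      rw [ENNReal.toReal_mul, ENNReal.toReal_sum fun x _ => h1 f x]
      refine congrArg _ (Finset.sum_congr rfl fun x _ => ?_)
      split_ifs
      · simp only [attachStep, PMF.ofFintype_apply, ENNReal.toReal_div, ENNReal.toReal_natCast,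
          attachWeight_eq_weight]
        norm_num
      · simp
    · exact fun f _ => ENNReal.mul_ne_top (PMF.apply_ne_top _ _)
        (ENNReal.sum_ne_top.2 fun x _ => h1 f x)
  simp only [oneEdgeExp, PMF.integral_eq_sum, smul_eq_mul, key, Finset.sum_mul, Finset.mul_sum]
  rw [Finset.sum_comm]
  refine Finset.sum_congr rfl fun f _ => ?_
  rw [Finset.sum_comm]
  refine Finset.sum_congr rfl fun x _ => ?_
  simp [mul_assoc]

theorem sum_weight_mul {t s : ℕ} (f : Fin t → Fin t) (hs : s ≤ t) (A B : ℝ) :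
    ∑ x : Fin (t + 1), weight f x / (2 * t + 1) * (A + (if (x : ℕ) = s then 1 else 0) * B) =
      A + weight f s * B / (2 * t + 1) := by
  have h : (2 * t + 1 : ℝ) ≠ 0 := by positivity
  have h1 : ∀ x : Fin (t + 1), (x : ℕ) = s ↔ x = ⟨s, Nat.lt_succ_of_le hs⟩ := by
    simp [Fin.ext_iff]
  simp only [mul_add, Finset.sum_add_distrib, ← Finset.sum_mul, ← Finset.sum_div, sum_weight, h1]
  simp only [ite_mul, one_mul, zero_mul, mul_ite, mul_zero, Finset.sum_ite_eq', Finset.mem_univ,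
    if_true]
  field_simp

/-! ### Exact attachment probabilities. -/

/-- The probability that vertex `v` attaches to `s ≤ v` (counting vertices from `0`). -/
noncomputable def attachProb (s v : ℕ) : ℝ :=
  (∏ j ∈ Finset.Ico s v, ((2 * j + 2) / (2 * j + 1) : ℝ)) / (2 * v + 1)

theorem weight_of_le {t s : ℕ} (f : Fin t → Fin t) (h : t ≤ s) : weight f s = 1 := by
  have : ∀ i, (f i : ℕ) ≠ s := fun i => ((f i).isLt.trans_le h).ne
  simp [weight, this]

theorem oneEdgeExp_weight {s t : ℕ} (h : s ≤ t) :
    oneEdgeExp t (fun f => weight f s) =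
      ∏ j ∈ Finset.Ico s t, ((2 * j + 2) / (2 * j + 1) : ℝ) := by
  induction t, h using Nat.le_induction with
  | base => simp [weight_of_le, oneEdgeExp_const]
  | succ t h ih =>
    rw [Finset.prod_Ico_succ_top h, ← ih, ← oneEdgeExp_mul_const, oneEdgeExp_succ]
    congr 1
    ext f
    have := sum_weight_mul f h (weight f s) 1
    simp only [weight_extend, mul_one] at this ⊢
    rw [this]
    field_simp
    ring

/-- A hit raises w(w + 1) by 2(w + 1) and has probability w/(2t + 1), so the mean is multiplied by
(2t + 3)/(2t + 1); the product telescopes. -/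
theorem oneEdgeExp_weight_mul {s t : ℕ} (h : s ≤ t) :
    oneEdgeExp t (fun f => weight f s * (weight f s + 1)) = 2 * (2 * t + 1) / (2 * s + 1) := by
  induction t, h using Nat.le_induction with
  | base =>
    have : (2 * s + 1 : ℝ) ≠ 0 := by positivity
    simp only [weight_of_le _ le_rfl, oneEdgeExp_const]
    field_simp
    norm_num
  | succ t h ih =>
    have e : (2 * ((2 * ((t + 1 : ℕ) : ℝ)) + 1) / (2 * s + 1) : ℝ) =
        2 * (2 * t + 1) / (2 * s + 1) * ((2 * t + 3) / (2 * t + 1)) := by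
      push_cast
      field_simp
      ring
    rw [e, ← ih, ← oneEdgeExp_mul_const, oneEdgeExp_succ]
    congr 1
    ext f
    have := sum_weight_mul f h (weight f s * (weight f s + 1)) (2 * (weight f s + 1))
    have e2 : ∀ x : Fin (t + 1), weight (extend f x) s * (weight (extend f x) s + 1) =
        weight f s * (weight f s + 1) +
          (if (x : ℕ) = s then 1 else 0) * (2 * (weight f s + 1)) := by
      intro x
      rw [weight_extend]
      split_ifs <;> ring
    simp only [e2, this]
    field_simp
    ring

theorem oneEdgeExp_of_extend {t : ℕ} {φ : (Fin (t + 1) → Fin (t + 1)) → ℝ}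
    {ψ : (Fin t → Fin t) → ℝ} (h : ∀ f x, φ (extend f x) = ψ f) :
    oneEdgeExp (t + 1) φ = oneEdgeExp t ψ := by
  rw [oneEdgeExp_succ]
  congr 1
  ext f
  have := sum_weight_mul f le_rfl (ψ f) 0
  simp only [mul_zero, add_zero, zero_div] at this
  simp only [h, this]

theorem oneEdgeExp_hits {s v n : ℕ} (hs : s ≤ v) (hv : v < n) :
    oneEdgeExp n (hits v s) = attachProb s v := by
  induction n, hv using Nat.le_induction with
  | base =>
    rw [attachProb, ← oneEdgeExp_weight hs, div_eq_mul_inv, ← oneEdgeExp_mul_const,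
      oneEdgeExp_succ]
    congr 1
    ext f
    have := sum_weight_mul f hs 0 1
    simp only [zero_add, mul_one] at this
    simp only [hits_extend_self, this, ← div_eq_mul_inv]
  | succ n h ih =>
    rw [← ih]
    exact oneEdgeExp_of_extend fun f x => hits_extend_of_lt f x s h

/-- When `u` hits `s` the weight becomes w + 1, so at time `u + 1` the mean is that of w(w + 1)/(2u
+ 1). Afterwards the indicator is frozen and the weight grows as usual. -/
theorem oneEdgeExp_hits_mul_weight {s u t : ℕ} (hs : s ≤ u) (hu : u < t) :
    oneEdgeExp t (fun f => hits u s f * weight f s) =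
      2 / (2 * s + 1) * ∏ j ∈ Finset.Ico (u + 1) t, ((2 * j + 2) / (2 * j + 1) : ℝ) := by
  induction t, hu using Nat.le_induction with
  | base =>
    have e : (2 / (2 * s + 1) : ℝ) = 2 * (2 * u + 1) / (2 * s + 1) * (2 * (u : ℝ) + 1)⁻¹ := by
      field_simp
    simp only [Nat.succ_eq_add_one, Finset.Ico_self, Finset.prod_empty, mul_one]
    rw [e, ← oneEdgeExp_weight_mul hs, ← oneEdgeExp_mul_const, oneEdgeExp_succ]
    congr 1
    ext f
    have := sum_weight_mul f hs 0 (weight f s + 1)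
    have e2 : ∀ x : Fin (u + 1), hits u s (extend f x) * weight (extend f x) s =
        0 + (if (x : ℕ) = s then 1 else 0) * (weight f s + 1) := by
      intro x
      rw [weight_extend, hits_extend_self]
      split_ifs <;> ring
    simp only [e2, this, ← div_eq_mul_inv]
    rw [zero_add]
  | succ t h ih =>
    rw [Finset.prod_Ico_succ_top h, ← mul_assoc, ← ih, ← oneEdgeExp_mul_const, oneEdgeExp_succ]
    congr 1
    ext f
    have := sum_weight_mul f (hs.trans (Nat.le_of_succ_le h)) (hits u s f * weight f s) (hits u s f)
    have e2 : ∀ x : Fin (t + 1), hits u s (extend f x) * weight (extend f x) s =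
        hits u s f * weight f s + (if (x : ℕ) = s then 1 else 0) * hits u s f := by
      intro x
      rw [weight_extend, hits_extend_of_lt f x s h]
      ring
    simp only [e2, this]
    field_simp
    ring

theorem oneEdgeExp_hits_mul_hits {s u v n : ℕ} (hs : s ≤ u) (huv : u < v) (hv : v < n) :
    oneEdgeExp n (fun f => hits u s f * hits v s f) =
      2 / (2 * s + 1) * attachProb (u + 1) v := by
  induction n, hv using Nat.le_induction with
  | base =>
    rw [attachProb, ← mul_div_assoc, ← oneEdgeExp_hits_mul_weight hs huv, div_eq_mul_inv,
      ← oneEdgeExp_mul_const, oneEdgeExp_succ]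
    congr 1
    ext f
    have := sum_weight_mul f (hs.trans huv.le) 0 (hits u s f)
    have e2 : ∀ x : Fin (v + 1), hits u s (extend f x) * hits v s (extend f x) =
        0 + (if (x : ℕ) = s then 1 else 0) * hits u s f := by
      intro x
      rw [hits_extend_self, hits_extend_of_lt f x s huv]
      ring
    simp only [e2, this]
    field_simp
    ring
  | succ n h ih =>
    rw [← ih]
    refine oneEdgeExp_of_extend fun f x => ?_
    rw [hits_extend_of_lt f x s h, hits_extend_of_lt f x s (huv.trans h)]

theorem oneEdgeExp_hits_of_lt {s v n : ℕ} (hs : v < s) (hv : v < n) :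
    oneEdgeExp n (hits v s) = 0 := by
  induction n, hv using Nat.le_induction with
  | base =>
    have e : ∀ x : Fin (v + 1), (x : ℕ) ≠ s := fun x => (x.isLt.trans_le hs).ne
    simp [oneEdgeExp_succ, hits_extend_self, e, oneEdgeExp_const]
  | succ n h ih =>
    rw [← ih]
    exact oneEdgeExp_of_extend fun f x => hits_extend_of_lt f x s h

/-! ### Common neighbours in the union of independent copies. -/

/-- The probability that both `u` and `v` have an edge to `s` in the union of `c` copies, when in
one copy these events have probabilities `a`, `b`, and `r` jointly. -/
noncomputable def commonProb (c : ℕ) (a b r : ℝ) : ℝ :=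
  1 - (1 - a) ^ c - (1 - b) ^ c + (1 - a - b + r) ^ c

theorem measureReal_lcdMeasure_forall (c n : ℕ) (S : Set (Fin n → Fin n)) :
    (lcdMeasure c n).real {F | ∀ k, F k ∈ S} = ((oneEdgeLaw n).toMeasure.real S) ^ c := by
  have : {F : Fin c → Fin n → Fin n | ∀ k, F k ∈ S} = Set.univ.pi fun _ => S := by
    ext F
    simp
  rw [this, measureReal_def, lcdMeasure, Measure.pi_pi]
  simp [measureReal_def]

theorem measureReal_oneEdgeLaw (n : ℕ) (S : Set (Fin n → Fin n)) {φ : (Fin n → Fin n) → ℝ}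
    (h1 : ∀ f ∈ S, φ f = 1) (h0 : ∀ f ∉ S, φ f = 0) :
    (oneEdgeLaw n).toMeasure.real S = oneEdgeExp n φ := by
  rw [oneEdgeExp, ← integral_indicator_one S.toFinite.measurableSet]
  congr 1
  ext f
  by_cases hf : f ∈ S
  · simp [hf, h1]
  · simp [hf, h0]

instance (c n : ℕ) : IsProbabilityMeasure (lcdMeasure c n) := by
  unfold lcdMeasure
  infer_instance

theorem oneEdgeExp_add (n : ℕ) (φ ψ : (Fin n → Fin n) → ℝ) :
    oneEdgeExp n (fun f => φ f + ψ f) = oneEdgeExp n φ + oneEdgeExp n ψ :=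
  integral_add .of_finite .of_finite

theorem oneEdgeExp_sub (n : ℕ) (φ ψ : (Fin n → Fin n) → ℝ) :
    oneEdgeExp n (fun f => φ f - ψ f) = oneEdgeExp n φ - oneEdgeExp n ψ :=
  integral_sub .of_finite .of_finite

theorem hits_val {n : ℕ} (v s : Fin n) (f : Fin n → Fin n) :
    hits v s f = if f v = s then 1 else 0 := by
  simp [hits, Fin.ext_iff]

/-- Inclusion–exclusion for the complement: the events that `u`, that `v`, and that both miss `s` in
every copy have probabilities that are `c`-th powers. -/
theorem measureReal_common_neighbour (c n : ℕ) (u v s : Fin n) :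
    (lcdMeasure c n).real {F | s ∈ nbhd (lcdGraph F) u ∩ nbhd (lcdGraph F) v} =
      commonProb c (oneEdgeExp n (hits u s)) (oneEdgeExp n (hits v s))
        (oneEdgeExp n fun f => hits u s f * hits v s f) := by
  have hA (w : Fin n) : (oneEdgeLaw n).toMeasure.real {f | f w ≠ s} =
      1 - oneEdgeExp n (hits w s) := by
    rw [measureReal_oneEdgeLaw n _ (φ := fun f => 1 - hits w s f), oneEdgeExp_sub,
      oneEdgeExp_const]
    · intro f hf
      rw [hits_val, if_neg hf, sub_zero]
    · intro f hf
      rw [hits_val, if_pos (not_not.1 hf), sub_self]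
  have hAB : (oneEdgeLaw n).toMeasure.real {f | f u ≠ s ∧ f v ≠ s} =
      1 - oneEdgeExp n (hits u s) - oneEdgeExp n (hits v s) +
        oneEdgeExp n (fun f => hits u s f * hits v s f) := by
    rw [measureReal_oneEdgeLaw n _
      (φ := fun f => 1 - hits u s f - hits v s f + hits u s f * hits v s f), oneEdgeExp_add,
      oneEdgeExp_sub, oneEdgeExp_sub, oneEdgeExp_const]
    · rintro f ⟨h1, h2⟩
      rw [hits_val, hits_val, if_neg h1, if_neg h2]
      norm_num
    · intro f hf
      rw [hits_val, hits_val]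
      by_cases h1 : f u = s
      · simp [h1]
      · have h2 : f v = s := by
          by_contra h2
          exact hf ⟨h1, h2⟩
        simp [h2]
  let A : Set (Fin c → Fin n → Fin n) := {F | ∀ k, F k ∈ {f | f u ≠ s}}
  let B : Set (Fin c → Fin n → Fin n) := {F | ∀ k, F k ∈ {f | f v ≠ s}}
  have hE : {F : Fin c → Fin n → Fin n | s ∈ nbhd (lcdGraph F) u ∩ nbhd (lcdGraph F) v} =
      (A ∪ B)ᶜ := by
    ext F
    simp [A, B, nbhd, lcdGraph]
  have hI : A ∩ B = {F | ∀ k, F k ∈ {f | f u ≠ s ∧ f v ≠ s}} := by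
    ext F
    simp [A, B, forall_and]
  have h1 := measureReal_union_add_inter (μ := lcdMeasure c n) (s := A) (t := B)
    B.toFinite.measurableSet
  rw [hI, measureReal_lcdMeasure_forall, hAB, measureReal_lcdMeasure_forall, hA,
    measureReal_lcdMeasure_forall, hA] at h1
  rw [hE, measureReal_compl (A ∪ B).toFinite.measurableSet, probReal_univ, commonProb]
  linarith

theorem integral_ncard {Ω V : Type*} [MeasurableSpace Ω] [Finite Ω] [MeasurableSingletonClass Ω]
    [Fintype V] (μ : Measure Ω) [IsFiniteMeasure μ] (S : Ω → Set V) :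
    ∫ ω, ((S ω).ncard : ℝ) ∂μ = ∑ s, μ.real {ω | s ∈ S ω} := by
  classical
  have h : ∀ ω, ((S ω).ncard : ℝ) = ∑ s, Set.indicator {ω | s ∈ S ω} (1 : Ω → ℝ) ω := by
    intro ω
    simp [Set.indicator_apply, Set.ncard_eq_toFinset_card']
  simp_rw [h]
  rw [integral_finsetSum _ fun _ _ => .of_finite]
  exact Finset.sum_congr rfl fun s _ => integral_indicator_one (Set.toFinite _).measurableSet

theorem expectedNScore_eq (c : ℕ) {n : ℕ} (p : Fin n ≃ Fin n) :
    expectedNScore c p = ∑ i : Fin (n - 1), ∑ s : Fin n,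
      (lcdMeasure c n).real {F | s ∈ nbhd (lcdGraph F) (p ⟨i, by omega⟩) ∩
        nbhd (lcdGraph F) (p ⟨i + 1, by omega⟩)} := by
  simp only [expectedNScore, nscore, Nat.cast_sum]
  rw [integral_finsetSum _ fun _ _ => .of_finite]
  exact Finset.sum_congr rfl fun i _ => integral_ncard _ _

/-- Add one copy at a time. The gain is 2cab + r up to terms of order (a + b)(ab + r), whose
accumulation is covered by the cubic factor. -/
theorem commonProb_bounds (c : ℕ) {a b r : ℝ} (hr : 0 ≤ r) (hra : r ≤ a) (hrb : r ≤ b)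
    (hab : a + b - r ≤ 1) :
    c * r + c * (c - 1) * (a * b) - 2 * c ^ 3 * ((a + b) * (a * b + r)) ≤ commonProb c a b r ∧
      commonProb c a b r ≤ c * r + c * (c - 1) * (a * b) := by
  induction c with
  | zero => simp [commonProb]
  | succ c ih =>
    have hγ0 : 0 ≤ 1 - a - b + r := by linarith
    have hγ1 : 1 - a - b + r ≤ 1 := by linarith
    have ha := hr.trans hra
    have hb := hr.trans hrb
    set γ := 1 - a - b + r with hγ
    -- The new copy creates the common neighbour by supplying the one missing edge (first two
    -- gains), or both edges at once when the old copies had neither.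
    have hstep : commonProb (c + 1) a b r = commonProb c a b r + a * ((1 - a) ^ c - γ ^ c) +
        b * ((1 - b) ^ c - γ ^ c) + r * γ ^ c := by
      simp only [commonProb, ← hγ, pow_succ]
      rw [hγ]
      ring
    have hpow1 : γ ^ c ≤ 1 := pow_le_one₀ hγ0 hγ1
    have hpow0 : 0 ≤ γ ^ c := pow_nonneg hγ0 c
    have hbern : 1 - c * (a + b) ≤ γ ^ c := by
      have := one_add_mul_le_pow (a := -(a + b - r)) (by linarith) c
      have e : 1 + -(a + b - r) = γ := by rw [hγ]; ring
      rw [e] at this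
      have : (c : ℝ) * r ≥ 0 := by positivity
      nlinarith
    -- The increments of the power lie between its derivatives at the two ends.
    have hdiff : ∀ x, γ ≤ x → x ≤ 1 → c * (x - γ) * (1 - c * (a + b)) ≤ x ^ c - γ ^ c ∧
        x ^ c - γ ^ c ≤ c * (x - γ) := by
      intro x hx hx1
      have hx0 := hγ0.trans hx
      have hg : x ^ c - γ ^ c = (∑ i ∈ Finset.range c, x ^ i * γ ^ (c - 1 - i)) * (x - γ) :=
        (Commute.all x γ).geom_sum₂_mul c |>.symm
      rw [hg]
      constructor
      · rw [mul_right_comm]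
        refine mul_le_mul_of_nonneg_right ?_ (by linarith)
        calc (c : ℝ) * (1 - c * (a + b)) ≤ c * γ ^ c := by gcongr
          _ = ∑ i ∈ Finset.range c, γ ^ c := by simp
          _ ≤ _ := by
            refine Finset.sum_le_sum fun i hi => ?_
            have hi := Finset.mem_range.1 hi
            calc γ ^ c ≤ γ ^ (i + (c - 1 - i)) :=
                  pow_le_pow_of_le_one hγ0 hγ1 (by omega)
              _ = γ ^ i * γ ^ (c - 1 - i) := pow_add _ _ _
              _ ≤ _ := by gcongr
      · refine mul_le_mul_of_nonneg_right ?_ (by linarith)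
        calc _ ≤ ∑ i ∈ Finset.range c, (1 : ℝ) := by
              refine Finset.sum_le_sum fun i _ => ?_
              exact mul_le_one₀ (pow_le_one₀ hx0 hx1) (pow_nonneg hγ0 _) (pow_le_one₀ hγ0 hγ1)
          _ = c := by simp
    obtain ⟨la, ua⟩ := hdiff (1 - a) (by linarith) (by linarith)
    obtain ⟨lb, ub⟩ := hdiff (1 - b) (by linarith) (by linarith)
    have ea : 1 - a - γ = b - r := by rw [hγ]; ring
    have eb : 1 - b - γ = a - r := by rw [hγ]; ring
    rw [ea] at la ua
    rw [eb] at lb ub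
    have mla := mul_le_mul_of_nonneg_left la ha
    have mua := mul_le_mul_of_nonneg_left ua ha
    have mlb := mul_le_mul_of_nonneg_left lb hb
    have mub := mul_le_mul_of_nonneg_left ub hb
    have mlr := mul_le_mul_of_nonneg_left hbern hr
    have mur := mul_le_mul_of_nonneg_left hpow1 hr
    rw [hstep]
    push_cast
    have hcR : (0 : ℝ) ≤ c := Nat.cast_nonneg c
    have hcc : (c : ℝ) ≤ (c : ℝ) ^ 2 := by exact_mod_cast Nat.le_self_pow two_ne_zero c
    have hX : 0 ≤ (a + b) * (a * b) := by positivity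
    have hY : 0 ≤ (a + b) * r := by positivity
    have hcY := mul_le_mul_of_nonneg_right hcc hY
    have hcX := mul_le_mul_of_nonneg_right hcc hX
    constructor
    · have e1 : a * (c * (b - r) * (1 - c * (a + b))) + b * (c * (a - r) * (1 - c * (a + b))) +
          r * (1 - c * (a + b)) = 2 * c * (a * b) + r - 2 * c ^ 2 * ((a + b) * (a * b))
            - 2 * c * ((a + b) * r) + c ^ 2 * ((a + b) * ((a + b) * r)) := by ring
      have e2 : 0 ≤ (c : ℝ) ^ 2 * ((a + b) * ((a + b) * r)) := by positivity
      have e3 : 0 ≤ (c : ℝ) ^ 2 * ((a + b) * r) := by positivity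
      have e4 : 0 ≤ (c : ℝ) ^ 2 * ((a + b) * (a * b)) := by positivity
      have e5 : 0 ≤ (c : ℝ) * ((a + b) * r) := by positivity
      have e6 : 0 ≤ (c : ℝ) * ((a + b) * (a * b)) := by positivity
      have e7 : 2 * ((c : ℝ) + 1) ^ 3 * ((a + b) * (a * b + r)) =
          2 * c ^ 3 * ((a + b) * (a * b + r)) + 6 * (c ^ 2 * ((a + b) * r)) +
          6 * (c ^ 2 * ((a + b) * (a * b))) + 6 * (c * ((a + b) * r)) +
          6 * (c * ((a + b) * (a * b))) + 2 * ((a + b) * r) + 2 * ((a + b) * (a * b)) := by ring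
      linarith [ih.1]
    · have e1 : a * (c * (b - r)) + b * (c * (a - r)) =
          2 * c * (a * b) - c * ((a + b) * r) := by ring
      have e5 : 0 ≤ (c : ℝ) * ((a + b) * r) := by positivity
      linarith [ih.2]

/-! ### Two-sided estimates with relative error O(1/s). -/

theorem attachProb_nonneg (s v : ℕ) : 0 ≤ attachProb s v := by
  unfold attachProb
  positivity

/-- Each squared factor lies between (2j + 3)/(2j + 1) and (4j + 5)/(4j + 1), and both of these
telescope. -/
theorem sq_attachProb_bounds {s v : ℕ} (h : s ≤ v) :
    1 / ((2 * s + 1) * (2 * v + 1) : ℝ) ≤ attachProb s v ^ 2 ∧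
      attachProb s v ^ 2 ≤ (4 * v + 1) / ((4 * s + 1) * (2 * v + 1) ^ 2 : ℝ) := by
  have key : ((2 * v + 1) / (2 * s + 1) : ℝ) ≤
        (∏ j ∈ Finset.Ico s v, ((2 * j + 2) / (2 * j + 1) : ℝ)) ^ 2 ∧
      (∏ j ∈ Finset.Ico s v, ((2 * j + 2) / (2 * j + 1) : ℝ)) ^ 2 ≤
        ((4 * v + 1) / (4 * s + 1) : ℝ) := by
    induction v, h using Nat.le_induction with
    | base =>
      have h1 : (2 * s + 1 : ℝ) ≠ 0 := by positivity
      have h2 : (4 * s + 1 : ℝ) ≠ 0 := by positivity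
      simp [h1, h2]
    | succ v h ih =>
      rw [Finset.prod_Ico_succ_top h, mul_pow]
      have hv : (0 : ℝ) ≤ v := Nat.cast_nonneg v
      have l : ((2 * v + 3) / (2 * v + 1) : ℝ) ≤ ((2 * v + 2) / (2 * v + 1)) ^ 2 := by
        rw [div_pow, div_le_div_iff₀ (by positivity) (by positivity)]
        nlinarith
      have u : ((2 * v + 2) / (2 * v + 1)) ^ 2 ≤ ((4 * v + 5) / (4 * v + 1) : ℝ) := by
        rw [div_pow, div_le_div_iff₀ (by positivity) (by positivity)]
        nlinarith
      constructor
      · refine le_trans (le_of_eq ?_)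
          (mul_le_mul ih.1 l (by positivity) (by positivity))
        push_cast
        field_simp
        ring
      · refine le_trans (mul_le_mul ih.2 u (by positivity) (by positivity)) (le_of_eq ?_)
        push_cast
        field_simp
        ring
  have hv : (0 : ℝ) < (2 * v + 1) ^ 2 := by positivity
  rw [attachProb, div_pow]
  constructor
  · refine le_trans (le_of_eq ?_) (div_le_div_of_nonneg_right key.1 hv.le)
    field_simp
  · refine le_trans (div_le_div_of_nonneg_right key.2 hv.le) (le_of_eq ?_)
    field_simp

theorem le_attachProb {s v : ℕ} (h : s ≤ v) :
    1 / (2 * √((s + 1 : ℝ) * (v + 1))) ≤ attachProb s v := by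
  rw [← sq_le_sq₀ (by positivity) (attachProb_nonneg s v), div_pow, mul_pow,
    Real.sq_sqrt (by positivity)]
  refine le_trans ?_ (sq_attachProb_bounds h).1
  rw [div_le_div_iff₀ (by positivity) (by positivity)]
  have hs : (0 : ℝ) ≤ s := Nat.cast_nonneg s
  have hv : (0 : ℝ) ≤ v := Nat.cast_nonneg v
  nlinarith

theorem attachProb_le {s v : ℕ} (h : s ≤ v) :
    attachProb s v ≤ (1 + 4 / (s + 1)) / (2 * √((s + 1 : ℝ) * (v + 1))) := by
  rw [← sq_le_sq₀ (attachProb_nonneg s v) (by positivity), div_pow, mul_pow,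
    Real.sq_sqrt (by positivity)]
  refine (sq_attachProb_bounds h).2.trans ?_
  have hs : (0 : ℝ) ≤ s := Nat.cast_nonneg s
  have hv : (0 : ℝ) ≤ v := Nat.cast_nonneg v
  have hsv : (s : ℝ) ≤ v := Nat.cast_le.2 h
  have h1 : ((4 * v + 1) / (2 * v + 1) ^ 2 : ℝ) ≤ (1 + 1 / (v + 1)) / (v + 1) := by
    rw [one_add_div (by positivity), div_div, div_le_div_iff₀ (by positivity) (by positivity)]
    nlinarith
  have h2 : (1 / (4 * s + 1) : ℝ) ≤ (1 + 3 / (s + 1)) / (4 * (s + 1)) := by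
    rw [one_add_div (by positivity), div_div, div_le_div_iff₀ (by positivity) (by positivity)]
    nlinarith
  have h3 : (1 / (v + 1) : ℝ) ≤ 1 / (s + 1) := one_div_le_one_div_of_le (by positivity) (by linarith)
  have h4 : (1 + 3 / (s + 1)) * (1 + 1 / (v + 1)) ≤ (1 + 4 / (s + 1) : ℝ) ^ 2 := by
    have e3 : (3 / (s + 1) : ℝ) = 3 * (1 / (s + 1)) := by ring
    have e4 : (4 / (s + 1) : ℝ) = 4 * (1 / (s + 1)) := by ring
    rw [e3, e4]
    have : (0 : ℝ) ≤ 1 / (s + 1) := by positivity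
    nlinarith
  calc ((4 * v + 1) / ((4 * s + 1) * (2 * v + 1) ^ 2) : ℝ)
      = 1 / (4 * s + 1) * ((4 * v + 1) / (2 * v + 1) ^ 2) := by field_simp
    _ ≤ (1 + 3 / (s + 1)) / (4 * (s + 1)) * ((1 + 1 / (v + 1)) / (v + 1)) := by gcongr
    _ = (1 + 3 / (s + 1)) * (1 + 1 / (v + 1)) / (2 ^ 2 * ((s + 1) * (v + 1))) := by
      field_simp
      norm_num
    _ ≤ _ := by gcongr

theorem le_jointProb {s u v : ℕ} (hs : s ≤ u) (huv : u < v) :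
    1 / (2 * ((s + 1) * √((u + 1 : ℝ) * (v + 1)))) ≤ 2 / (2 * s + 1) * attachProb (u + 1) v := by
  have h0 := attachProb_nonneg (u + 1) v
  rw [← sq_le_sq₀ (by positivity) (by positivity), div_pow, mul_pow, mul_pow,
    Real.sq_sqrt (by positivity), mul_pow]
  refine le_trans ?_ (mul_le_mul_of_nonneg_left (sq_attachProb_bounds huv).1 (by positivity))
  push_cast
  rw [div_pow, div_mul_div_comm, div_le_div_iff₀ (by positivity) (by positivity)]
  have hs0 : (0 : ℝ) ≤ s := Nat.cast_nonneg s
  have hv0 : (0 : ℝ) ≤ v := Nat.cast_nonneg v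
  have hsu : (s : ℝ) ≤ u := Nat.cast_le.2 hs
  -- Since 2u + 3 exceeds 2(u + 1), it must be paired with 2s + 1; this is where `s ≤ u` enters.
  have h1 : (2 * s + 1 : ℝ) * (2 * (u + 1) + 1) ≤ 4 * ((s + 1) * (u + 1)) := by nlinarith
  have h2 : (2 * s + 1 : ℝ) * (2 * v + 1) ≤ 4 * ((s + 1) * (v + 1)) := by nlinarith
  have := mul_le_mul h1 h2 (by positivity) (by positivity)
  linarith

theorem jointProb_le {s u v : ℕ} (hs : s ≤ u) (huv : u < v) :
    2 / (2 * s + 1) * attachProb (u + 1) v ≤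
      (1 + 9 / (s + 1)) / (2 * ((s + 1) * √((u + 1 : ℝ) * (v + 1)))) := by
  have hs0 : (0 : ℝ) ≤ s := Nat.cast_nonneg s
  have hsu : (s : ℝ) ≤ u := Nat.cast_le.2 hs
  have h1 : (2 / (2 * s + 1) : ℝ) ≤ (1 + 1 / (s + 1)) / (s + 1) := by
    rw [one_add_div (by positivity), div_div, div_le_div_iff₀ (by positivity) (by positivity)]
    nlinarith
  have h2 : attachProb (u + 1) v ≤ (1 + 4 / (s + 1)) / (2 * √((u + 1 : ℝ) * (v + 1))) := by
    refine (attachProb_le huv).trans ?_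
    push_cast
    gcongr <;> linarith
  have h4 : (1 + 1 / (s + 1)) * (1 + 4 / (s + 1)) ≤ (1 + 9 / (s + 1) : ℝ) := by
    have e9 : (9 / (s + 1) : ℝ) = 9 * (1 / (s + 1)) := by ring
    have e4 : (4 / (s + 1) : ℝ) = 4 * (1 / (s + 1)) := by ring
    rw [e9, e4]
    have h0 : (0 : ℝ) ≤ 1 / (s + 1) := by positivity
    have h1 : (1 / (s + 1) : ℝ) ≤ 1 := by
      rw [div_le_one (by positivity)]
      linarith
    nlinarith
  calc _ ≤ (1 + 1 / (s + 1)) / (s + 1) * ((1 + 4 / (s + 1)) / (2 * √((u + 1 : ℝ) * (v + 1)))) :=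
        mul_le_mul h1 h2 (attachProb_nonneg _ _) (by positivity)
    _ = (1 + 1 / (s + 1)) * (1 + 4 / (s + 1)) / (2 * ((s + 1) * √((u + 1 : ℝ) * (v + 1)))) := by
      field_simp
    _ ≤ _ := by gcongr

/-- Since √(SU)√(SV) = S√(UV), both ab and r are multiples of Z = 1/(S√(UV)), near Z/4 and Z/2, so
the main term is (c/2 + c(c - 1)/4)Z. -/
theorem abs_commonProb_sub_le_of_bounds (c : ℕ) {a b r S U V : ℝ} (hr0 : 0 ≤ r) (hra : r ≤ a)
    (hrb : r ≤ b) (hab : a + b - r ≤ 1) (hS : 1 ≤ S) (hSU : S ≤ U) (hSV : S ≤ V)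
    (la : 1 / (2 * √(S * U)) ≤ a) (lb : 1 / (2 * √(S * V)) ≤ b)
    (ua : a ≤ (1 + 4 / S) / (2 * √(S * U))) (ub : b ≤ (1 + 4 / S) / (2 * √(S * V)))
    (lr : 1 / (2 * (S * √(U * V))) ≤ r) (ur : r ≤ (1 + 9 / S) / (2 * (S * √(U * V)))) :
    |commonProb c a b r - c * (c + 1) / (4 * (S * √(U * V)))| ≤
      (113 * c ^ 3 + 6 * c ^ 2) * (1 / (S ^ 2 * √(U * V))) := by
  obtain ⟨hl, hu⟩ := commonProb_bounds c hr0 hra hrb hab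
  have ha : 0 ≤ a := hr0.trans hra
  have hb : 0 ≤ b := hr0.trans hrb
  have hS0 : 0 < S := by linarith
  have hU0 : 0 < U := by linarith
  have hV0 : 0 < V := by linarith
  have hX : √(S * U) * √(S * V) = S * √(U * V) := by
    rw [← Real.sqrt_mul (by positivity), show S * U * (S * V) = S ^ 2 * (U * V) by ring,
      Real.sqrt_mul (by positivity), Real.sqrt_sq hS0.le]
  have hSsqrt : ∀ W, S ≤ W → S ≤ √(S * W) := fun W hW =>
    Real.le_sqrt_of_sq_le (by nlinarith)
  have hX0 : 0 < √(U * V) := by positivity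
  have hη1 : 1 / S ≤ 1 := by rw [div_le_one hS0]; exact hS
  have hη0 : 0 < 1 / S := by positivity
  have small : ∀ W x, S ≤ W → x ≤ (1 + 4 / S) / (2 * √(S * W)) → x ≤ 5 / 2 * (1 / S) := by
    intro W x hW hx
    refine hx.trans ?_
    have h5 : 1 + 4 / S ≤ 5 := by
      have : 4 / S = 4 * (1 / S) := by ring
      linarith
    calc (1 + 4 / S) / (2 * √(S * W)) ≤ 5 / (2 * S) := by
          gcongr
          exact hSsqrt W hW
      _ = _ := by ring
  have sa := small U a hSU ua
  have sb := small V b hSV ub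
  have lab := mul_le_mul la lb (by positivity) ha
  have uab := mul_le_mul ua ub hb (by positivity)
  have e1 : 1 / (2 * √(S * U)) * (1 / (2 * √(S * V))) = 1 / 4 * (1 / (S * √(U * V))) := by
    rw [← hX]
    field_simp
    norm_num
  have e2 : (1 + 4 / S) / (2 * √(S * U)) * ((1 + 4 / S) / (2 * √(S * V))) =
      (1 + 4 * (1 / S)) ^ 2 / 4 * (1 / (S * √(U * V))) := by
    rw [← hX]
    field_simp
    norm_num
  have e3 : 1 / (2 * (S * √(U * V))) = 1 / 2 * (1 / (S * √(U * V))) := by field_simp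
  have e4 : (1 + 9 / S) / (2 * (S * √(U * V))) =
      (1 + 9 * (1 / S)) / 2 * (1 / (S * √(U * V))) := by field_simp
  have e5 : c * (c + 1) / (4 * (S * √(U * V))) = c * (c + 1) / 4 * (1 / (S * √(U * V))) := by
    field_simp
  have e6 : 1 / (S ^ 2 * √(U * V)) = 1 / S * (1 / (S * √(U * V))) := by field_simp
  rw [e1] at lab
  rw [e2] at uab
  rw [e3] at lr
  rw [e4] at ur
  rw [e5, e6]
  have hZ0 : 0 < 1 / (S * √(U * V)) := by positivity
  generalize 1 / (S * √(U * V)) = Z at *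
  generalize 1 / S = η at *
  have uab' : a * b ≤ 1 / 4 * Z + 6 * (η * Z) := by
    have hsq : η * η ≤ η := mul_le_of_le_one_left hη0.le hη1
    have : (1 + 4 * η) ^ 2 / 4 ≤ 1 / 4 + 6 * η := by linarith
    calc a * b ≤ (1 + 4 * η) ^ 2 / 4 * Z := uab
      _ ≤ (1 / 4 + 6 * η) * Z := mul_le_mul_of_nonneg_right this hZ0.le
      _ = _ := by ring
  have hηZ : 0 < η * Z := by positivity
  have hηZ' : η * Z ≤ Z := mul_le_of_le_one_left hZ0.le hη1
  have hcc : (0 : ℝ) ≤ c * (c - 1) := by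
    rcases c with _ | c
    · simp
    · push_cast
      have : (0 : ℝ) ≤ c := Nat.cast_nonneg c
      nlinarith
  have hc : (0 : ℝ) ≤ c := Nat.cast_nonneg c
  have hc3 : (0 : ℝ) ≤ c ^ 3 := by positivity
  -- Here ab ≤ 25Z/4 and r ≤ 5Z. Doubling gives 112.5, rounded up to 113; the errors 6c(c - 1) and
  -- 9c/2 in the main term fit into 6c².
  have herr : (a + b) * (a * b + r) ≤ 5 * η * (45 / 4 * Z) := by
    refine mul_le_mul (by linarith) (by linarith) (by positivity) (by positivity)
  have herr' := mul_le_mul_of_nonneg_left herr hc3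
  have m1 := mul_le_mul_of_nonneg_left lab hcc
  have m2 := mul_le_mul_of_nonneg_left uab' hcc
  have m3 := mul_le_mul_of_nonneg_left lr hc
  have m4 := mul_le_mul_of_nonneg_left ur hc
  have p1 : 0 ≤ (c : ℝ) * (η * Z) := by positivity
  have p2 : 0 ≤ (c : ℝ) ^ 2 * (η * Z) := by positivity
  have p3 : 0 ≤ (c : ℝ) ^ 3 * (η * Z) := by positivity
  rw [abs_le]
  constructor <;> linarith

theorem abs_commonProb_attachProb_sub_le (c : ℕ) {s u v n : ℕ} (hs : s ≤ u) (huv : u < v)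
    (hv : v < n) :
    |commonProb c (oneEdgeExp n (hits u s)) (oneEdgeExp n (hits v s))
        (oneEdgeExp n fun f => hits u s f * hits v s f) -
      c * (c + 1) / (4 * ((s + 1) * √((u + 1 : ℝ) * (v + 1))))| ≤
      (113 * c ^ 3 + 6 * c ^ 2) * (1 / ((s + 1) ^ 2 * √((u + 1 : ℝ) * (v + 1)))) := by
  have hh : ∀ w (f : Fin n → Fin n), 0 ≤ hits w s f ∧ hits w s f ≤ 1 := by
    intro w f
    unfold hits
    split_ifs <;> norm_num
  have hr0 : 0 ≤ oneEdgeExp n fun f => hits u s f * hits v s f :=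
    (oneEdgeExp_const n 0).symm.le.trans
      (oneEdgeExp_mono n fun f => mul_nonneg (hh u f).1 (hh v f).1)
  have hra : oneEdgeExp n (fun f => hits u s f * hits v s f) ≤ oneEdgeExp n (hits u s) :=
    oneEdgeExp_mono n fun f => mul_le_of_le_one_right (hh u f).1 (hh v f).2
  have hrb : oneEdgeExp n (fun f => hits u s f * hits v s f) ≤ oneEdgeExp n (hits v s) :=
    oneEdgeExp_mono n fun f => mul_le_of_le_one_left (hh v f).1 (hh u f).2
  have hab : oneEdgeExp n (hits u s) + oneEdgeExp n (hits v s) -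
      oneEdgeExp n (fun f => hits u s f * hits v s f) ≤ 1 := by
    rw [← oneEdgeExp_add, ← oneEdgeExp_sub]
    refine le_trans (oneEdgeExp_mono n fun f => ?_) (oneEdgeExp_const n 1).le
    have h1 := hh u f
    have h2 := hh v f
    nlinarith
  rw [oneEdgeExp_hits_mul_hits hs huv hv, oneEdgeExp_hits hs (huv.trans hv),
    oneEdgeExp_hits (hs.trans huv.le) hv] at *
  exact abs_commonProb_sub_le_of_bounds c hr0 hra hrb hab (by simp) (by simpa using hs)
    (by simpa using hs.trans huv.le) (le_attachProb hs) (le_attachProb (hs.trans huv.le))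
    (attachProb_le hs) (attachProb_le (hs.trans huv.le)) (le_jointProb hs huv) (jointProb_le hs huv)

theorem abs_common_neighbour_sub_le (c : ℕ) {n : ℕ} {u v : Fin n} (huv : u ≠ v) (s : Fin n) :
    |(lcdMeasure c n).real {F | s ∈ nbhd (lcdGraph F) u ∩ nbhd (lcdGraph F) v} -
      (if (s : ℕ) + 1 ≤ min (time u) (time v) then
        c * (c + 1) / (4 * (((s + 1 : ℕ) : ℝ) * √((time u : ℝ) * time v))) else 0)| ≤
      if (s : ℕ) + 1 ≤ min (time u) (time v) then
        (113 * c ^ 3 + 6 * c ^ 2) * (1 / (((s + 1 : ℕ) : ℝ) ^ 2 * √((time u : ℝ) * time v)))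
      else 0 := by
  wlog h : u < v generalizing u v
  · have := this huv.symm (lt_of_le_of_ne (not_lt.1 h) huv.symm)
    simp_rw [Set.inter_comm (nbhd _ v)] at this
    rwa [min_comm, mul_comm (time v : ℝ)] at this
  rw [measureReal_common_neighbour]
  have hmin : (s : ℕ) + 1 ≤ min (time u) (time v) ↔ (s : ℕ) ≤ u := by
    have : (u : ℕ) < v := h
    simp only [time]
    omega
  simp only [hmin]
  split_ifs with hs
  · simpa [time] using abs_commonProb_attachProb_sub_le c hs h v.isLt
  · have ha := oneEdgeExp_hits_of_lt (not_le.1 hs) u.isLt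
    have hr : oneEdgeExp n (fun f => hits u s f * hits v s f) = 0 := by
      refine le_antisymm ?_ ?_
      · rw [← ha]
        refine oneEdgeExp_mono n fun f => ?_
        unfold hits
        split_ifs <;> norm_num
      · rw [← oneEdgeExp_const n 0]
        refine oneEdgeExp_mono n fun f => ?_
        unfold hits
        split_ifs <;> norm_num
    simp [ha, hr, commonProb]

/-! ### Harmonic sums along an ordering. -/

theorem sum_fin_ite_eq_sum_Icc {n m : ℕ} (h : m ≤ n) (g : ℕ → ℝ) :
    ∑ s : Fin n, (if (s : ℕ) + 1 ≤ m then g (s + 1) else 0) = ∑ a ∈ Finset.Icc 1 m, g a := by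
  have hm : Finset.filter (fun s => s + 1 ≤ m) (Finset.range n) = Finset.Ico 0 m := by
    ext x
    simp only [Finset.mem_Ico, Finset.mem_filter, Finset.mem_range]
    omega
  rw [Fin.sum_univ_eq_sum_range (fun s => if s + 1 ≤ m then g (s + 1) else 0) n,
    ← Finset.sum_filter, hm, Finset.sum_Ico_add' g 0 m 1]
  rfl

theorem sum_Icc_one_div_sq_le (m : ℕ) : ∑ a ∈ Finset.Icc 1 m, 1 / (a : ℝ) ^ 2 ≤ 2 := by
  -- Strengthened so that the induction telescopes; at `m = 0` the convention `1 / 0 = 0` keeps it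
  -- true.
  have key : ∑ a ∈ Finset.Icc 1 m, 1 / (a : ℝ) ^ 2 ≤ 2 - 1 / (m : ℝ) := by
    induction m with
    | zero => simp
    | succ m ih =>
      rw [Finset.sum_Icc_succ_top (by omega)]
      rcases Nat.eq_zero_or_pos m with rfl | hm
      · norm_num
      · have hm' : (0 : ℝ) < m := Nat.cast_pos.2 hm
        have : 1 / ((m + 1 : ℕ) : ℝ) ^ 2 ≤ 1 / m - 1 / ((m + 1 : ℕ) : ℝ) := by
          push_cast
          rw [div_sub_div _ _ (by positivity) (by positivity),
            div_le_div_iff₀ (by positivity) (by positivity)]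
          nlinarith
        linarith
  have : (0 : ℝ) ≤ 1 / m := by positivity
  linarith

/-- The harmonic numbers, as reals. -/
noncomputable def harm (m : ℕ) : ℝ := ∑ a ∈ Finset.Icc 1 m, 1 / (a : ℝ)

theorem harm_nonneg (m : ℕ) : 0 ≤ harm m := Finset.sum_nonneg fun _ _ => by positivity

theorem harm_mono : Monotone harm := fun _ _ h =>
  Finset.sum_le_sum_of_subset_of_nonneg (Finset.Icc_subset_Icc_right h) fun _ _ _ => by positivity

theorem tendsto_harm : Filter.Tendsto harm Filter.atTop Filter.atTop := by
  refine Real.tendsto_sum_range_one_div_nat_succ_atTop.congr fun m => ?_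
  rw [harm, Finset.range_eq_Ico]
  have := Finset.sum_Ico_add' (fun a : ℕ => 1 / (a : ℝ)) 0 m 1
  push_cast at this
  rw [this]
  rfl

/-- The sum `∑ᵢ g (pᵢ, pᵢ₊₁)` over consecutive vertices of an ordering, named by arrival times. -/
noncomputable def pathSum {n : ℕ} (p : Fin n ≃ Fin n) (g : ℕ → ℕ → ℝ) : ℝ :=
  ∑ i : Fin (n - 1), g (time (p ⟨i, by omega⟩)) (time (p ⟨i + 1, by omega⟩))

/-- The sum over consecutive vertices of `(pᵢ pᵢ₊₁) ^ (-1 / 2)`. -/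
noncomputable def sqrtSum {n : ℕ} (p : Fin n ≃ Fin n) : ℝ :=
  pathSum p fun x y => 1 / √((x : ℝ) * y)

/-- The double sum of `attachSum` without the factor `c (c + 1)`. -/
noncomputable def harmSum {n : ℕ} (p : Fin n ≃ Fin n) : ℝ :=
  pathSum p fun x y => harm (min x y) / √((x : ℝ) * y)

theorem attachSum_eq (c : ℕ) {n : ℕ} (p : Fin n ≃ Fin n) :
    attachSum c p = c * (c + 1) * harmSum p := by
  simp only [attachSum, harmSum, pathSum, harm, Finset.mul_sum, Finset.sum_div]
  refine Finset.sum_congr rfl fun i _ => Finset.sum_congr rfl fun a _ => ?_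
  rw [div_div, mul_one_div]

theorem abs_expectedNScore_sub_le (c : ℕ) {n : ℕ} (p : Fin n ≃ Fin n) :
    |expectedNScore c p - 1 / 4 * attachSum c p| ≤
      2 * (113 * c ^ 3 + 6 * c ^ 2) * sqrtSum p := by
  rw [expectedNScore_eq, attachSum, sqrtSum, pathSum, Finset.mul_sum, Finset.mul_sum,
    ← Finset.sum_sub_distrib]
  refine (Finset.abs_sum_le_sum_abs _ _).trans (Finset.sum_le_sum fun i _ => ?_)
  have hne : p ⟨i, by omega⟩ ≠ p ⟨i + 1, by omega⟩ := by
    simp [Fin.ext_iff]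
  generalize p ⟨i, by omega⟩ = u at *
  generalize p ⟨i + 1, by omega⟩ = v at *
  have hm : min (time u) (time v) ≤ n := (min_le_left _ _).trans u.isLt
  have h1 := sum_fin_ite_eq_sum_Icc hm
    fun a => c * (c + 1) / (4 * ((a : ℝ) * √((time u : ℝ) * time v)))
  have h2 := sum_fin_ite_eq_sum_Icc hm
    fun a => (113 * c ^ 3 + 6 * c ^ 2) * (1 / ((a : ℝ) ^ 2 * √((time u : ℝ) * time v)))
  have e1 : 1 / 4 * ∑ a ∈ Finset.Icc 1 (min (time u) (time v)),
      (c * (c + 1) : ℝ) / (a * √((time u : ℝ) * (time v : ℝ))) =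
      ∑ a ∈ Finset.Icc 1 (min (time u) (time v)),
        (c * (c + 1) : ℝ) / (4 * ((a : ℝ) * √((time u : ℝ) * time v))) := by
    rw [Finset.mul_sum]
    exact Finset.sum_congr rfl fun a _ => by rw [div_mul_div_comm, one_mul]
  rw [e1, ← h1, ← Finset.sum_sub_distrib]
  refine (Finset.abs_sum_le_sum_abs _ _).trans
    ((Finset.sum_le_sum fun s _ => abs_common_neighbour_sub_le c hne s).trans ?_)
  rw [h2, ← Finset.mul_sum]
  have e2 : ∑ a ∈ Finset.Icc 1 (min (time u) (time v)),
      1 / ((a : ℝ) ^ 2 * √((time u : ℝ) * time v)) =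
      (∑ a ∈ Finset.Icc 1 (min (time u) (time v)), 1 / (a : ℝ) ^ 2) *
        (1 / √((time u : ℝ) * time v)) := by
    rw [Finset.sum_mul]
    exact Finset.sum_congr rfl fun a _ => by rw [div_mul_div_comm, one_mul]
  rw [e2, mul_comm (2 : ℝ), mul_assoc]
  gcongr
  exact sum_Icc_one_div_sq_le _

theorem pathSum_mono {n : ℕ} (p : Fin n ≃ Fin n) {g h : ℕ → ℕ → ℝ}
    (H : ∀ x y, 1 ≤ x → x ≤ n → 1 ≤ y → y ≤ n → g x y ≤ h x y) : pathSum p g ≤ pathSum p h :=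
  Finset.sum_le_sum fun _ _ => H _ _ (Nat.le_add_left _ _) (Fin.isLt _) (Nat.le_add_left _ _)
    (Fin.isLt _)

theorem pathSum_add {n : ℕ} (p : Fin n ≃ Fin n) (g h : ℕ → ℕ → ℝ) :
    pathSum p (fun x y => g x y + h x y) = pathSum p g + pathSum p h :=
  Finset.sum_add_distrib

theorem pathSum_mul {n : ℕ} (p : Fin n ≃ Fin n) (r : ℝ) (g : ℕ → ℕ → ℝ) :
    pathSum p (fun x y => r * g x y) = r * pathSum p g :=
  (Finset.mul_sum _ _ _).symm

theorem sum_comp_le {n m : ℕ} (e : Fin m → Fin n) (he : Function.Injective e) {g : Fin n → ℝ}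
    (hg : ∀ x, 0 ≤ g x) : ∑ i, g (e i) ≤ ∑ x, g x := by
  classical
  rw [← Finset.sum_image (s := Finset.univ) (f := g) fun _ _ _ _ h => he h]
  exact Finset.sum_le_sum_of_subset_of_nonneg (Finset.subset_univ _) fun x _ _ => hg x

/-- Each vertex belongs to at most two consecutive pairs. -/
theorem pathSum_add_le {n : ℕ} (p : Fin n ≃ Fin n) {g : ℕ → ℝ} (hg : ∀ x, 0 ≤ g x) :
    pathSum p (fun x y => g x + g y) ≤ 2 * ∑ x : Fin n, g (time x) := by
  rw [pathSum_add, two_mul]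
  refine add_le_add (sum_comp_le (g := fun x => g (time x))
      (fun i : Fin (n - 1) => p ⟨i, by omega⟩) (fun i j h => ?_) fun x => hg _)
    (sum_comp_le (g := fun x => g (time x))
      (fun i : Fin (n - 1) => p ⟨i + 1, by omega⟩) (fun i j h => ?_) fun x => hg _)
  all_goals
    have := congrArg Fin.val (p.injective h)
    simp only at this
    exact Fin.ext (by omega)

/-- At most `2 K` consecutive pairs have a member that arrives before time `K`. -/
theorem pathSum_early_le {n : ℕ} (p : Fin n ≃ Fin n) (K : ℕ) :
    pathSum p (fun x y => (if x < K then 1 else 0) + if y < K then 1 else 0) ≤ 2 * K := by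
  refine (pathSum_add_le p (g := fun x => if x < K then 1 else 0) fun x => ?_).trans ?_
  · split_ifs <;> norm_num
  · gcongr
    rw [← Finset.sum_filter, Finset.sum_const, nsmul_one]
    refine Nat.cast_le.2 ?_
    have := Finset.card_le_card_of_injOn (s := Finset.univ.filter fun x : Fin n => time x < K)
      (t := Finset.range K) Fin.val (fun x hx => by
        have := (Finset.mem_filter.1 hx).2
        exact Finset.mem_range.2 (Nat.lt_of_succ_lt this)) Fin.val_injective.injOn
    simpa using this

/-- If either vertex is early, the bracket is at most 0 and nothing is claimed; otherwise this is
monotonicity. -/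
theorem harm_le_harm_min (K x y : ℕ) :
    harm K * (1 - ((if x < K then 1 else 0) + if y < K then 1 else 0)) ≤ harm (min x y) := by
  have h0 := harm_nonneg K
  by_cases h : K ≤ min x y
  · have h1 : ¬ x < K := by omega
    have h2 : ¬ y < K := by omega
    simpa [h1, h2] using harm_mono h
  · refine le_trans (mul_nonpos_of_nonneg_of_nonpos h0 ?_) (harm_nonneg _)
    have : x < K ∨ y < K := by omega
    rcases this with h | h
    · simp only [h, if_true]
      split_ifs <;> norm_num
    · simp only [h, if_true]
      split_ifs <;> norm_num

theorem harm_mul_sqrtSum_le {n : ℕ} (p : Fin n ≃ Fin n) (K : ℕ) :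
    harm K * sqrtSum p ≤ harm K * (2 * K) + harmSum p := by
  refine le_trans ?_ (add_le_add_left
    (mul_le_mul_of_nonneg_left (pathSum_early_le p K) (harm_nonneg K)) _)
  rw [sqrtSum, harmSum, ← pathSum_mul, ← pathSum_mul, ← pathSum_add]
  refine pathSum_mono p fun x y hx _ hy _ => ?_
  have h := harm_le_harm_min K x y
  set z : ℝ := (if x < K then 1 else 0) + if y < K then 1 else 0
  have hz : 0 ≤ z := by
    simp only [z]
    split_ifs <;> norm_num
  have hx' : (1 : ℝ) ≤ x := Nat.one_le_cast.2 hx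
  have hy' : (1 : ℝ) ≤ y := Nat.one_le_cast.2 hy
  have hs : 1 ≤ √((x : ℝ) * y) := Real.one_le_sqrt.2 (by nlinarith)
  have hs1 : 1 / √((x : ℝ) * y) ≤ 1 := by rw [div_le_one (by linarith)]; exact hs
  have hs0 : 0 < 1 / √((x : ℝ) * y) := by positivity
  rw [div_eq_mul_one_div (harm (min x y))]
  have h1 := mul_le_mul_of_nonneg_right h hs0.le
  have h2 : harm K * z * (1 / √((x : ℝ) * y)) ≤ harm K * z :=
    mul_le_of_le_one_right (mul_nonneg (harm_nonneg K) hz) hs1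
  nlinarith

theorem harm_mul_le_harmSum {n : ℕ} (p : Fin n ≃ Fin n) (K : ℕ) :
    harm K * (n - 1 - 2 * K) ≤ n * harmSum p := by
  have h1 : harm K * ((n - 1 : ℕ) : ℝ) - harm K * (2 * K) ≤ n * harmSum p := by
    rw [sub_le_iff_le_add']
    refine le_trans ?_ (add_le_add_left
      (mul_le_mul_of_nonneg_left (pathSum_early_le p K) (harm_nonneg K)) _)
    have : ((n - 1 : ℕ) : ℝ) = pathSum p fun _ _ => 1 := by simp [pathSum]
    rw [harmSum, this, ← pathSum_mul, ← pathSum_mul, ← pathSum_mul, ← pathSum_add]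
    refine pathSum_mono p fun x y hx hxn hy hyn => ?_
    have h := harm_le_harm_min K x y
    have hx' : (1 : ℝ) ≤ x := Nat.one_le_cast.2 hx
    have hy' : (1 : ℝ) ≤ y := Nat.one_le_cast.2 hy
    have hxn' : (x : ℝ) ≤ n := Nat.cast_le.2 hxn
    have hyn' : (y : ℝ) ≤ n := Nat.cast_le.2 hyn
    have hs0 : 0 < √((x : ℝ) * y) := by positivity
    have hs : √((x : ℝ) * y) ≤ n := Real.sqrt_le_iff.2 ⟨by positivity, by nlinarith⟩
    have h3 : harm (min x y) ≤ n * (harm (min x y) / √((x : ℝ) * y)) := by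
      rw [mul_div_assoc', le_div_iff₀ hs0, mul_comm]
      exact mul_le_mul_of_nonneg_right hs (harm_nonneg _)
    linarith
  have h2 : ((n : ℝ) - 1) ≤ ((n - 1 : ℕ) : ℝ) := by
    have : n ≤ (n - 1) + 1 := by omega
    have : (n : ℝ) ≤ ((n - 1 : ℕ) : ℝ) + 1 := by exact_mod_cast this
    linarith
  have := mul_le_mul_of_nonneg_left h2 (harm_nonneg K)
  linarith

theorem exists_le_harmSum (M : ℝ) :
    ∃ n₀ : ℕ, ∀ n ≥ n₀, ∀ p : Fin n ≃ Fin n, M ≤ harmSum p := by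
  obtain ⟨K, hK⟩ := (tendsto_harm.eventually_ge_atTop (2 * M)).exists
  -- This makes n - 1 - 2K at least n/2, so the sum is at least half of `harm K`.
  refine ⟨4 * K + 2, fun n hn p => ?_⟩
  have h := harm_mul_le_harmSum p K
  have hn' : (4 * K + 2 : ℝ) ≤ n := by exact_mod_cast hn
  have hn0 : (0 : ℝ) < n := lt_of_lt_of_le (by positivity) hn'
  have h0 := harm_nonneg K
  refine le_of_mul_le_mul_left (le_trans ?_ h) hn0
  nlinarith

theorem exists_sqrtSum_le {δ : ℝ} (hδ : 0 < δ) :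
    ∃ n₀ : ℕ, ∀ n ≥ n₀, ∀ p : Fin n ≃ Fin n, sqrtSum p ≤ δ * harmSum p := by
  obtain ⟨K, hK⟩ := (tendsto_harm.eventually_ge_atTop (2 / δ)).exists
  obtain ⟨n₀, h₀⟩ := exists_le_harmSum (harm K * (2 * K))
  refine ⟨n₀, fun n hn p => ?_⟩
  have h1 := harm_mul_sqrtSum_le p K
  have h2 := h₀ n hn p
  have hK0 : 0 < harm K := lt_of_lt_of_le (by positivity) hK
  have hB : 0 ≤ harmSum p :=
    le_trans (mul_nonneg hK0.le (by positivity)) h2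
  refine le_of_mul_le_mul_left (a := harm K) ?_ hK0
  have h3 : 2 ≤ harm K * δ := (div_le_iff₀ hδ).1 hK
  nlinarith

/-- AM-GM splits each pair into one term per vertex, and a vertex lies in at most two pairs, which
cancels the factor 1/2. -/
theorem harmSum_le_sum {n : ℕ} (p : Fin n ≃ Fin n) :
    harmSum p ≤ ∑ x : Fin n, harm (time x) / time x := by
  have h := pathSum_add_le p (g := fun x => 1 / 2 * (harm x / x)) fun x =>
    mul_nonneg (by norm_num) (div_nonneg (harm_nonneg x) (Nat.cast_nonneg x))
  rw [← Finset.mul_sum, ← mul_assoc, mul_one_div_cancel two_ne_zero, one_mul] at h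
  refine le_trans (pathSum_mono p fun x y hx _ hy _ => ?_) h
  have hx' : (0 : ℝ) < x := Nat.cast_pos.2 hx
  have hy' : (0 : ℝ) < y := Nat.cast_pos.2 hy
  have hm := harm_nonneg (min x y)
  have hs : 1 / √((x : ℝ) * y) ≤ 1 / 2 * (1 / x + 1 / y) := by
    rw [Real.sqrt_mul hx'.le]
    have e : ∀ z : ℝ, 0 < z → 1 / z = (1 / √z) ^ 2 := fun z hz => by
      rw [div_pow, Real.sq_sqrt hz.le, one_pow]
    rw [e x hx', e y hy', ← one_div_mul_one_div]
    nlinarith [sq_nonneg (1 / √(x : ℝ) - 1 / √(y : ℝ))]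
  calc harm (min x y) / √((x : ℝ) * y) = harm (min x y) * (1 / √((x : ℝ) * y)) :=
        div_eq_mul_one_div _ _
    _ ≤ harm (min x y) * (1 / 2 * (1 / x + 1 / y)) := by gcongr
    _ = 1 / 2 * (harm (min x y) / x) + 1 / 2 * (harm (min x y) / y) := by ring
    _ ≤ 1 / 2 * (harm x / x) + 1 / 2 * (harm y / y) := by
      gcongr
      · exact harm_mono (min_le_left _ _)
      · exact harm_mono (min_le_right _ _)

/-- In arrival order, replacing H(x)/x by H(x - 1)/√((x - 1)x) loses at most 1/x². These losses
total at most 2, and the first vertex accounts for 1. -/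
theorem sum_le_harmSum_refl (n : ℕ) :
    ∑ x : Fin n, harm (time x) / time x ≤ harmSum (Equiv.refl (Fin n)) + 3 := by
  rcases n with _ | n
  · simp [harmSum, pathSum]
  · have hsq : ∑ i : Fin n, 1 / ((i : ℝ) + 2) ^ 2 ≤ 2 := by
      have h1 := sum_fin_ite_eq_sum_Icc le_rfl (n := n + 1) fun a => 1 / (a : ℝ) ^ 2
      have h2 := sum_Icc_one_div_sq_le (n + 1)
      rw [← h1, Fin.sum_univ_succ] at h2
      refine le_trans (le_trans (Finset.sum_le_sum fun i _ => ?_)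
        (le_add_of_nonneg_left (by simp))) h2
      have : (i.succ : ℕ) + 1 ≤ n + 1 := i.succ.isLt
      rw [if_pos this]
      push_cast [Fin.val_succ]
      apply le_of_eq
      ring
    have hterm : ∀ i : Fin n, harm ((i : ℕ) + 2) / ((i : ℝ) + 2) ≤
        harm (min ((i : ℕ) + 1) (i + 2)) / √(((i : ℝ) + 1) * (i + 2)) +
          1 / ((i : ℝ) + 2) ^ 2 := by
      intro i
      have hi : (0 : ℝ) ≤ (i : ℕ) := Nat.cast_nonneg _
      have h1 : harm ((i : ℕ) + 2) = harm ((i : ℕ) + 1) + 1 / ((i : ℝ) + 2) := by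
        rw [harm, Finset.sum_Icc_succ_top (by omega), harm]
        push_cast
        ring
      have h2 : √(((i : ℝ) + 1) * (i + 2)) ≤ (i : ℝ) + 2 :=
        Real.sqrt_le_iff.2 ⟨by positivity, by nlinarith⟩
      rw [h1, add_div, div_div, ← sq, min_eq_left (by omega)]
      gcongr
      exact harm_nonneg _
    rw [Fin.sum_univ_succ]
    have h0 : harm (time (0 : Fin (n + 1))) / time (0 : Fin (n + 1)) = 1 := by
      simp [time, harm]
    have hB : harmSum (Equiv.refl (Fin (n + 1))) = ∑ i : Fin n,
        harm (min ((i : ℕ) + 1) (i + 2)) / √(((i : ℝ) + 1) * (i + 2)) := by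
      simp only [harmSum, pathSum, time, Equiv.refl_apply]
      refine Finset.sum_congr rfl fun i _ => ?_
      push_cast
      rw [show (i : ℝ) + 1 + 1 = i + 2 by ring]
    have hS : ∑ i : Fin n, harm (time i.succ) / time i.succ =
        ∑ i : Fin n, harm ((i : ℕ) + 2) / ((i : ℝ) + 2) := by
      refine Finset.sum_congr rfl fun i _ => ?_
      simp only [time, Fin.val_succ]
      push_cast
      rw [show (i : ℝ) + 1 + 1 = i + 2 by ring]
    rw [h0, hS, hB]
    have := Finset.sum_le_sum fun (i : Fin n) (_ : i ∈ Finset.univ) => hterm i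
    rw [Finset.sum_add_distrib] at this
    linarith

/-! ### The asymptotic formula and optimality. -/

theorem expectedNScore_asymptotic (c : ℕ) {ε : ℝ} (hε : 0 < ε) :
    ∃ n₀ : ℕ, ∀ n ≥ n₀, ∀ p : Fin n ≃ Fin n,
      |expectedNScore c p - (1 / 4) * attachSum c p| ≤ ε * ((1 / 4) * attachSum c p) := by
  -- For `c = 0` the error constant vanishes and cannot serve as the divisor in δ.
  rcases Nat.eq_zero_or_pos c with rfl | hc
  · refine ⟨0, fun n _ p => ?_⟩
    simpa [attachSum_eq] using abs_expectedNScore_sub_le 0 p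
  · have hc' : (0 : ℝ) < c := Nat.cast_pos.2 hc
    set C : ℝ := 2 * (113 * c ^ 3 + 6 * c ^ 2) with hC
    have hC0 : 0 < C := by positivity
    obtain ⟨n₀, h⟩ := exists_sqrtSum_le (δ := ε * (c * (c + 1)) / (4 * C)) (by positivity)
    refine ⟨n₀, fun n hn p => (abs_expectedNScore_sub_le c p).trans ?_⟩
    refine (mul_le_mul_of_nonneg_left (h n hn p) hC0.le).trans (le_of_eq ?_)
    rw [attachSum_eq]
    field_simp

theorem attachSum_le_attachSum_refl (c : ℕ) {ε : ℝ} (hε : 0 < ε) :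
    ∃ n₀ : ℕ, ∀ n ≥ n₀, ∀ p : Fin n ≃ Fin n,
      attachSum c p ≤ (1 + ε) * attachSum c (Equiv.refl (Fin n)) := by
  obtain ⟨n₀, h⟩ := exists_le_harmSum (3 / ε)
  refine ⟨n₀, fun n hn p => ?_⟩
  have h1 := (div_le_iff₀ hε).1 (h n hn (Equiv.refl _))
  have h2 := (harmSum_le_sum p).trans (sum_le_harmSum_refl n)
  rw [attachSum_eq, attachSum_eq, mul_left_comm]
  gcongr
  linarith

theorem attachSum_nonneg (c : ℕ) {n : ℕ} (p : Fin n ≃ Fin n) : 0 ≤ attachSum c p :=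
  Finset.sum_nonneg fun _ _ => Finset.sum_nonneg fun _ _ => by positivity

end PrefAttach

theorem mainTheorem2 (c : ℕ) (ε : ℝ) (hε : 0 < ε) :
    (∃ n₀ : ℕ, ∀ n ≥ n₀, ∀ p : Fin n ≃ Fin n,
      |PrefAttach.expectedNScore c p - (1 / 4) * PrefAttach.attachSum c p| ≤
        ε * ((1 / 4) * PrefAttach.attachSum c p)) ∧
    (∃ n₀ : ℕ, ∀ n ≥ n₀, ∀ p : Fin n ≃ Fin n,
      PrefAttach.expectedNScore c p ≤
        (1 + ε) * PrefAttach.expectedNScore c (Equiv.refl (Fin n))) := by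
  refine ⟨PrefAttach.expectedNScore_asymptotic c hε, ?_⟩
  -- Three η-losses must fit into ε: 3η + η² ≤ 7η/2 ≤ 7ε/20, while ε(1 - η) ≥ ε/2.
  set η := min (1 / 2) (ε / 10)
  have hη0 : 0 < η := lt_min (by norm_num) (by positivity)
  have hη1 : η ≤ 1 / 2 := min_le_left _ _
  have hη2 : η ≤ ε / 10 := min_le_right _ _
  obtain ⟨n₁, h₁⟩ := PrefAttach.expectedNScore_asymptotic c hη0
  obtain ⟨n₂, h₂⟩ := PrefAttach.attachSum_le_attachSum_refl c hη0
  refine ⟨max n₁ n₂, fun n hn p => ?_⟩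
  have a1 := (abs_le.1 (h₁ n (le_of_max_le_left hn) p)).2
  have a2 := (abs_le.1 (h₁ n (le_of_max_le_left hn) (Equiv.refl _))).1
  have a3 := h₂ n (le_of_max_le_right hn) p
  have hA := PrefAttach.attachSum_nonneg c (Equiv.refl (Fin n))
  set A := PrefAttach.attachSum c (Equiv.refl (Fin n))
  have hη : (1 + η) * (1 + η) ≤ (1 + ε) * (1 - η) := by nlinarith
  calc PrefAttach.expectedNScore c p ≤ (1 + η) * (1 / 4 * PrefAttach.attachSum c p) := by linarith
    _ ≤ (1 + η) * (1 / 4 * ((1 + η) * A)) := by gcongr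
    _ = (1 + η) * (1 + η) * (1 / 4 * A) := by ring
    _ ≤ (1 + ε) * (1 - η) * (1 / 4 * A) := by gcongr
    _ = (1 + ε) * ((1 - η) * (1 / 4 * A)) := by ring
    _ ≤ _ := by
      gcongr
      linarith
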